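/- **Setting.** Fix a field $\mathbb F$. For a finite $X\subset\mathbb R^n$ let $\mathrm{Dgm}_\ell(X)$ be the degree-$\ell$ persistence diagram (over $\mathbb F$) of the filtration by Čech complexes $\check C_r(X)=\{\emptyset\neq\sigma\subseteq X : \bigcap_{x\in\sigma}\overline B_r(x)\ne\emptyset\}$, $r\ge 0$: the finite multiset of pairs $(b,d)$ in $\Delta=\{(b,d)\in\mathbb R^2: b<d\}$ that correspond to the intervals $[b,d)$ with $d<\infty$ of the persistence module. Put $D(X)=\bigcup_{\ell=0}^{n-1}\mathrm{Dgm}_\ell(X)$ (with multiplicities) and $\mathrm{pers}(b,d)=d-b$. For a simple point process $\xi$ on $\mathbb R^n$ and a bounded Borel set $A$ let $X_\xi(A)$ be the set of atoms of $\xi$ in $A$, and let $$\rho(A)=\sum_{x\in D(X_{\xi}(A))}\delta_x,\qquad \mathfrak p(A)=\mathbb E[\rho(A)],\qquad E^\alpha(\xi,A)=\sum_{x\in D(X_\xi(A))}\mathrm{pers}(x)^\alpha .$$ The map $\mathfrak p$ is the persistence diagram expectation measure of $\xi$; it exists if, for every bounded Borel set $A$, $\rho(A)$ is a random measure and $\mathfrak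 p(A)$ is a Radon measure on $\Delta$; it is nonzero if $\mathfrak p(A)\ne0$ for some bounded Borel set $A$. A convex averaging sequence is an increasing sequence $(A_k)$ of bounded convex Borel sets in $\mathbb R^n$ whose inradii tend to $\infty$ and whose quermassintegrals satisfy $W_{n-1}(A_k)=O(\lambda_n(A_k)^{1/n})$. Fix such a sequence. For $\alpha>0$ define $$\beta_\alpha(\xi)=\limsup_{k\to\infty}\frac{\log\mathbb E[E^\alpha(\xi,A_k)]}{\log\mathbb E[\xi(A_k)]}\in[-\infty,\infty],\qquad \dim_{\mathrm{PH}}^\alpha(\xi)=\frac{\alpha}{1-\beta_\alpha(\xi)},$$ with the convention $\alpha/0=\infty$. **Lemma.** Let $0<T_0<T_1$ and let $(\xi(t))_{t\in(T_0,T_1)}$ be simple stationary point processes on $\mathbb R^n$ having all finite moments and such that $\mathbb E[\xi(t)(A)]>0$ for all bounded Borel sets $A$ with $\lambda_n(A)>0$. Suppose that their persistence diagram expectation measures $\mathfrak p(t)$ exist, are nonzero and scale self-similarly with exponents $\eta_1,\eta_2\in\mathbb R$: for all $t,t'\in(T_0,T_1)$ and all sufficiently large $k$, $$\mathfrak p(t)(A_k)(B)=(t/t')^{-\eta_2}\,\mathfrak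 p(t')(A_k)\big((t/t')^{-\eta_1}B\big)\qquad\text{for all Borel sets } B\subseteq\Delta,$$ where $\kappa B=\{(\kappa b,\kappa d):(b,d)\in B\}$. Suppose moreover that for all $t,t'\in(T_0,T_1)$ $$\lim_{k\to\infty}\frac{\log\mathbb E[\xi(t')(A_k)]}{\log\mathbb E[\xi(t)(A_k)]}=1 .$$ Then for every $\alpha>0$ and all $t,t'\in(T_0,T_1)$, $$\beta_\alpha(\xi(t))=\beta_\alpha(\xi(t'))\qquad\text{and}\qquad \dim_{\mathrm{PH}}^\alpha(\xi(t))=\dim_{\mathrm{PH}}^\alpha(\xi(t')).$$ -/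

import Mathlib

open MeasureTheory ProbabilityTheory Filter Topology Set
open scoped ENNReal NNReal Pointwise BigOperators

noncomputable section

namespace PersistentScaling

/-- Euclidean space `ℝⁿ`. -/
abbrev E (n : ℕ) : Type := EuclideanSpace ℝ (Fin n)

/-! ### Čech complexes and their simplicial homology over a field -/

section Homology

variable {V : Type*} (F : Type*) [Field F]

/-- Simplicial `ℓ`-chains in the vertex set `V`: the free vector space on the ordered
simplices `(v₀, …, v_ℓ)`. -/
abbrev Chain (V : Type*) (ℓ : ℕ) : Type _ := (Fin (ℓ + 1) → V) →₀ F

/-- The boundary operator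
`∂ (v₀, …, v_{ℓ+1}) = ∑ i, (-1)^i (v₀, …, v_{i-1}, v_{i+1}, …, v_{ℓ+1})`. -/
def boundaryMap (V : Type*) (ℓ : ℕ) : Chain F V (ℓ + 1) →ₗ[F] Chain F V ℓ :=
  Finsupp.lsum F fun v : Fin (ℓ + 1 + 1) → V =>
    ∑ i : Fin (ℓ + 1 + 1), ((-1 : F) ^ (i : ℕ)) • Finsupp.lsingle (v ∘ i.succAbove)

open Classical in
/-- The chains of a simplicial complex `K`: those supported on the ordered simplices whose set of
vertices is a face of `K` (the ordered simplicial chain complex of `K`). -/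
def chains (K : PreAbstractSimplicialComplex V) (ℓ : ℕ) : Submodule F (Chain F V ℓ) :=
  Finsupp.supported F F {v | Finset.univ.image v ∈ K}

/-- The `ℓ`-cycles of `K`. -/
def cycles (K : PreAbstractSimplicialComplex V) : (ℓ : ℕ) → Submodule F (Chain F V ℓ)
  | 0 => chains F K 0
  | ℓ + 1 => chains F K (ℓ + 1) ⊓ LinearMap.ker (boundaryMap F V ℓ)

/-- The `ℓ`-boundaries of `K`. -/
def boundaries (K : PreAbstractSimplicialComplex V) (ℓ : ℕ) : Submodule F (Chain F V ℓ) :=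
  (chains F K (ℓ + 1)).map (boundaryMap F V ℓ)

/-- The quotient `Z / (B ∩ Z)` for subspaces `B`, `Z` of a vector space. -/
abbrev Subquotient {M : Type*} [AddCommGroup M] [Module F M] (Z B : Submodule F M) : Type _ :=
  Z ⧸ B.submoduleOf Z

/-- The map `Z / (B ∩ Z) → Z' / (B' ∩ Z')` induced by inclusions `Z ⊆ Z'` and `B ⊆ B'`. -/
def subquotientMap {M : Type*} [AddCommGroup M] [Module F M] {Z B Z' B' : Submodule F M}
    (hZ : Z ≤ Z') (hB : B ≤ B') : Subquotient F Z B →ₗ[F] Subquotient F Z' B' :=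
  Submodule.mapQ (B.submoduleOf Z) (B'.submoduleOf Z') (Submodule.inclusion hZ) fun _ hz => hB hz

/-- The `ℓ`-th simplicial homology of `K` with coefficients in `F`. -/
abbrev Homology (K : PreAbstractSimplicialComplex V) (ℓ : ℕ) : Type _ :=
  Subquotient F (cycles F K ℓ) (boundaries F K ℓ)

theorem chains_mono {K L : PreAbstractSimplicialComplex V} (h : K ≤ L) (ℓ : ℕ) :
    chains F K ℓ ≤ chains F L ℓ :=
  Finsupp.supported_mono fun _ hv => h hv

theorem cycles_mono {K L : PreAbstractSimplicialComplex V} (h : K ≤ L) (ℓ : ℕ) :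
    cycles F K ℓ ≤ cycles F L ℓ := by
  cases ℓ with
  | zero => exact chains_mono F h 0
  | succ ℓ => exact inf_le_inf_right _ (chains_mono F h (ℓ + 1))

theorem boundaries_mono {K L : PreAbstractSimplicialComplex V} (h : K ≤ L) (ℓ : ℕ) :
    boundaries F K ℓ ≤ boundaries F L ℓ :=
  Submodule.map_mono (chains_mono F h (ℓ + 1))

/-- The linear map in homology induced by the inclusion `K ⊆ L`. -/
def homologyMap {K L : PreAbstractSimplicialComplex V} (h : K ≤ L) (ℓ : ℕ) :
    Homology F K ℓ →ₗ[F] Homology F L ℓ :=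
  subquotientMap F (cycles_mono F h ℓ) (boundaries_mono F h ℓ)

end Homology

section Cech

variable {n : ℕ}

/-- The Čech complex of radius `r` of `X`: the nonempty finite `σ ⊆ X` such that the closed balls of
radius `r` around the points of `σ` have a common point. (It is empty for `r < 0`.) -/
def cech (X : Set (E n)) (r : ℝ) : PreAbstractSimplicialComplex (E n) where
  faces := {σ | σ.Nonempty ∧ (σ : Set (E n)) ⊆ X ∧ (⋂ x ∈ σ, Metric.closedBall x r).Nonempty}
  isRelLowerSet_faces := by
    rintro σ ⟨hne, hX, y, hy⟩
    refine ⟨hne, fun τ hτσ hτ => ⟨hτ, ?_, y, ?_⟩⟩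
    · exact fun x hx => hX (hτσ hx)
    · simp only [Set.mem_iInter] at hy ⊢
      exact fun x hx => hy x (hτσ hx)

theorem cech_mono (X : Set (E n)) {r s : ℝ} (h : r ≤ s) : cech X r ≤ cech X s := by
  rintro σ ⟨hne, hX, y, hy⟩
  refine ⟨hne, hX, y, ?_⟩
  simp only [Set.mem_iInter] at hy ⊢
  exact fun x hx => Metric.closedBall_subset_closedBall h (hy x hx)

variable (F : Type*) [Field F]

/-- The persistent Betti number `β_ℓ^{r,s}`: the rank of `H_ℓ(Č_r(X)) → H_ℓ(Č_s(X))`, `r ≤ s`. -/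
def persistentBetti (X : Set (E n)) (ℓ : ℕ) (r s : ℝ) : ℕ :=
  if h : r ≤ s then
    Module.finrank F (LinearMap.range (homologyMap F (cech_mono X h) ℓ))
  else 0

/-- The half plane `Δ = {(b, d) | b < d}`, with its Borel `σ`-algebra. -/
abbrev Delta : Type := {x : ℝ × ℝ // x.1 < x.2}

/-- The persistence `d - b` of `(b, d)`. -/
def pers (x : Delta) : ℝ := x.1.2 - x.1.1

/-- The multiplicity of `x = (b, d)` in the `ℓ`-th persistence diagram of the Čech filtration, i.e.
the number of intervals `[b, d)` in the interval decomposition of the persistence module. For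
`0 < ε < d - b` the number in the infimum counts the intervals with birth in `(b - ε, b]` and death
in `(d - ε, d]`; it decreases to the multiplicity of `(b, d)` as `ε` decreases to `0`. -/
def multiplicity (X : Set (E n)) (ℓ : ℕ) (x : Delta) : ℕ :=
  ⨅ ε : Set.Ioo (0 : ℝ) (pers x),
    (persistentBetti F X ℓ x.1.1 (x.1.2 - ε) + persistentBetti F X ℓ (x.1.1 - ε) x.1.2)
      - (persistentBetti F X ℓ (x.1.1 - ε) (x.1.2 - ε) + persistentBetti F X ℓ x.1.1 x.1.2)

open Classical in
/-- The `ℓ`-th persistence diagram of `X`, the finite multiset of the pairs `(b, d)` with their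
multiplicities. (The set of pairs of nonzero multiplicity is finite whenever `X` is finite;
the value for infinite `X` is irrelevant.) -/
def diagram (X : Set (E n)) (ℓ : ℕ) : Multiset Delta :=
  if h : (Function.support (multiplicity F X ℓ)).Finite then
    Finsupp.toMultiset (Finsupp.ofSupportFinite (multiplicity F X ℓ) h)
  else 0

/-- The union (with multiplicities) of the persistence diagrams in the degrees `0, …, n - 1`. -/
def totalDiagram (X : Set (E n)) : Multiset Delta :=
  ∑ ℓ ∈ Finset.range n, diagram F X ℓ

end Cech

/-! ### Point processes on `ℝⁿ` -/

section PointProcess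

variable {n : ℕ} {Ω : Type*} [MeasurableSpace Ω]

/-- A point process: a measurable map into the integer-valued boundedly finite measures. -/
structure IsPointProcess (ξ : Ω → Measure (E n)) : Prop where
  measurable : Measurable ξ
  integer_valued : ∀ ω, ∀ A : Set (E n), MeasurableSet A → Bornology.IsBounded A →
    ∃ m : ℕ, ξ ω A = m

/-- Almost surely all atoms are distinct. -/
def IsSimple (P : Measure Ω) (ξ : Ω → Measure (E n)) : Prop :=
  ∀ᵐ ω ∂P, ∀ x : E n, ξ ω {x} ≤ 1

/-- For every `x`, the translate `θ_x ξ`, `(θ_x ξ)(A) = ξ(A + x)`, has the same law as `ξ`. -/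
def IsStationary (P : Measure Ω) (ξ : Ω → Measure (E n)) : Prop :=
  ∀ x : E n, IdentDistrib (fun ω => (ξ ω).map (fun y => y - x)) ξ P P

/-- `𝔼[ξ(A)^k] < ∞` for all `k ≥ 1` and all bounded Borel sets `A`. -/
def HasAllFiniteMoments (P : Measure Ω) (ξ : Ω → Measure (E n)) : Prop :=
  ∀ k : ℕ, 1 ≤ k → ∀ A : Set (E n), MeasurableSet A → Bornology.IsBounded A →
    ∫⁻ ω, (ξ ω A) ^ k ∂P < ∞

/-- `𝔼[ξ(A)] > 0` for all bounded Borel sets `A` of positive Lebesgue measure. -/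
def HasPositiveFirstMoments (P : Measure Ω) (ξ : Ω → Measure (E n)) : Prop :=
  ∀ A : Set (E n), MeasurableSet A → Bornology.IsBounded A → 0 < volume A →
    0 < ∫⁻ ω, ξ ω A ∂P

/-- The point cloud of the atoms of a counting measure `μ` in `A`. -/
def pointCloud (μ : Measure (E n)) (A : Set (E n)) : Set (E n) := {x ∈ A | μ {x} ≠ 0}

variable (F : Type*) [Field F]

/-- The persistence diagram measure `ρ_ω(A) = ∑ δ_x`, the sum over the points `x` of the total
persistence diagram of the point cloud in `A`. -/
def diagramMeasure (ξ : Ω → Measure (E n)) (A : Set (E n)) (ω : Ω) : Measure Delta :=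
  ((totalDiagram F (pointCloud (ξ ω) A)).map Measure.dirac).sum

/-- The persistence diagram expectation measure `𝔭(A)`, the first moment measure
`B ↦ 𝔼[ρ_ω(A)(B)]`. -/
def expectationMeasure (P : Measure Ω) (ξ : Ω → Measure (E n)) (A : Set (E n)) :
    Measure Delta :=
  P.bind (diagramMeasure F ξ A)

/-- The persistence diagram expectation measure exists: for every bounded Borel set `A`, `ρ_ω(A)` is
a random measure on `Δ` (that is, measurable in `ω`, up to null sets) and its first moment measure
is a Radon measure on `Δ`. -/
structure ExpectationMeasureExists (P : Measure Ω) (ξ : Ω → Measure (E n)) : Prop where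
  aemeasurable : ∀ A : Set (E n), MeasurableSet A → Bornology.IsBounded A →
    AEMeasurable (diagramMeasure F ξ A) P
  radon : ∀ A : Set (E n), MeasurableSet A → Bornology.IsBounded A →
    IsFiniteMeasureOnCompacts (expectationMeasure F P ξ A)

/-- The map `A ↦ 𝔭(A)` on the bounded Borel sets is not identically zero. -/
def ExpectationMeasureNonzero (P : Measure Ω) (ξ : Ω → Measure (E n)) : Prop :=
  ∃ A : Set (E n), MeasurableSet A ∧ Bornology.IsBounded A ∧ expectationMeasure F P ξ A ≠ 0

end PointProcess

/-! ### Convex averaging sequences -/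

section Averaging

variable {n : ℕ}

/-- The supremum of the radii of the balls contained in `A`. -/
def inradius (A : Set (E n)) : ℝ≥0∞ :=
  ⨆ (r : ℝ≥0) (_ : ∃ x : E n, Metric.closedBall x (r : ℝ) ⊆ A), (r : ℝ≥0∞)

/-- `W 0, …, W n` are the coefficients in Steiner's formula
`λ(C + δ B) = ∑ i, (n choose i) (W i) δ^i` for all `δ ≥ 0`, where `B` is the closed unit ball. -/
def IsSteiner (C : Set (E n)) (W : ℕ → ℝ) : Prop :=
  ∀ δ : ℝ, 0 ≤ δ → (volume (C + δ • Metric.closedBall (0 : E n) 1)).toReal =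
    ∑ i ∈ Finset.range (n + 1), (n.choose i : ℝ) * W i * δ ^ i

open Classical in
/-- The `i`-th quermassintegral `W_i(C)` (`0 ≤ i ≤ n`) of a bounded convex set, defined through
Steiner's formula, which determines it. -/
def quermassintegral (C : Set (E n)) (i : ℕ) : ℝ :=
  if h : ∃ W : ℕ → ℝ, IsSteiner C W then h.choose i else 0

structure IsConvexAveragingSequence (A : ℕ → Set (E n)) : Prop where
  measurableSet : ∀ k, MeasurableSet (A k)
  isBounded : ∀ k, Bornology.IsBounded (A k)
  convex : ∀ k, Convex ℝ (A k)
  subset_succ : ∀ k, A k ⊆ A (k + 1)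
  inradius_tendsto : Tendsto (fun k => inradius (A k)) atTop (𝓝 ∞)
  quermassintegral_isBigO : (fun k => quermassintegral (A k) (n - 1)) =O[atTop]
    (fun k => (volume (A k)).toReal ^ (1 / (n : ℝ)))

end Averaging

/-! ### Self-similar scaling and the persistent homology fractal dimension -/

section Scaling

variable {n : ℕ} {Ω : Type*} [MeasurableSpace Ω] (F : Type*) [Field F]

/-- `κ B = {(κ b, κ d) | (b, d) ∈ B}`, as a subset of `Δ` (for `κ > 0`). -/
def scaleSet (κ : ℝ) (B : Set Delta) : Set Delta :=
  {y | ∃ x ∈ B, (y : ℝ × ℝ) = (κ * x.1.1, κ * x.1.2)}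

/-- The persistence diagram expectation measures `𝔭(t)` of the processes `ξ t` scale self-similarly
between `T₀` and `T₁` with exponents `η₁, η₂` (along the convex averaging sequence `A`). -/
def ScalesSelfSimilarly (P : Measure Ω) (ξ : ℝ → Ω → Measure (E n)) (A : ℕ → Set (E n))
    (T₀ T₁ η₁ η₂ : ℝ) : Prop :=
  ∀ t ∈ Set.Ioo T₀ T₁, ∀ t' ∈ Set.Ioo T₀ T₁, ∀ᶠ k in atTop, ∀ B : Set Delta, MeasurableSet B →
    expectationMeasure F P (ξ t) (A k) B =
      ENNReal.ofReal ((t / t') ^ (-η₂)) *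
        expectationMeasure F P (ξ t') (A k) (scaleSet ((t / t') ^ (-η₁)) B)

/-- `𝔼[ξ(A)]`. -/
def meanCount (P : Measure Ω) (ξ : Ω → Measure (E n)) (A : Set (E n)) : ℝ :=
  ∫ ω, (ξ ω A).toReal ∂P

/-- `E^α(ξ, A)`: the sum of `pers(x)^α` over the total persistence diagram of the points in `A`. -/
def totalPersistence (α : ℝ) (ξ : Ω → Measure (E n)) (A : Set (E n)) (ω : Ω) : ℝ :=
  ((totalDiagram F (pointCloud (ξ ω) A)).map fun x => pers x ^ α).sum

/-- `β = limsup_k log 𝔼[E^α(ξ, A_k)] / log 𝔼[ξ(A_k)]`, in the extended real numbers. -/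
def growthExponent (P : Measure Ω) (α : ℝ) (ξ : Ω → Measure (E n)) (A : ℕ → Set (E n)) : EReal :=
  limsup (fun k =>
    ((Real.log (∫ ω, totalPersistence F α ξ (A k) ω ∂P) / Real.log (meanCount P ξ (A k)) : ℝ) :
      EReal)) atTop

/-- The persistent homology fractal dimension `α / (1 - β)`, with `α / 0 = ∞`. -/
def dimPH (P : Measure Ω) (α : ℝ) (ξ : Ω → Measure (E n)) (A : ℕ → Set (E n)) : EReal :=
  open Classical in
  if growthExponent F P α ξ A = 1 then ⊤ else (α : EReal) / (1 - growthExponent F P α ξ A)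

end Scaling

end PersistentScaling

end

open MeasureTheory ProbabilityTheory Filter Topology Set
open scoped ENNReal NNReal Pointwise

namespace PersistentScaling

/-! ### Limits superior under asymptotically trivial affine changes -/

/-! Campbell's formula (`integral_totalPersistence`) writes the expected total persistence as the
integral of `pers ^ α` against the expectation measure. Self-similar scaling makes the measures at
`t` and `t'` agree up to a dilation and a constant factor, and `pers ^ α` is homogeneous of degree
`α`. The two expectations on `A k` therefore differ by a positive constant independent of `k`
(`eventually_integral_totalPersistence_eq`).

After taking logarithms this constant becomes a bounded additive error, which vanishes on division
by the logarithm of the mean count, since that tends to infinity (`tendsto_meanCount_atTop`):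
stationarity makes the intensity measure a Haar measure, and the `A k` contain arbitrarily large
balls. The assumed ratio limit makes the two denominators interchangeable. This yields one
inequality between the exponents (`limsup_log_div_log_le`); exchanging `t` and `t'` yields the
other. -/

theorem limsup_coe_affine_le {a b u v : ℕ → ℝ} (hu : Tendsto u atTop (𝓝 1))
    (hv : Tendsto v atTop (𝓝 0)) (hb : ∀ᶠ k in atTop, b k = u k * a k + v k) :
    limsup (fun k => (b k : EReal)) atTop ≤ limsup (fun k => (a k : EReal)) atTop := by
  refine EReal.le_of_forall_lt_iff_le.1 fun z hz => ?_
  -- A real `w` strictly between leaves room: eventually `b k ≤ u k * w + v k`, whose limit `w` is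
  -- below `z`. Working in `EReal` removes any boundedness requirement.
  obtain ⟨w, hw, hwz⟩ := EReal.lt_iff_exists_real_btwn.1 hz
  have hlim : Tendsto (fun k => u k * w + v k) atTop (𝓝 w) := by
    simpa using (hu.mul_const w).add hv
  refine limsup_le_of_le (by isBoundedDefault) ?_
  filter_upwards [eventually_lt_of_limsup_lt hw, hb, hu.eventually_const_lt one_pos,
    hlim.eventually_lt_const (EReal.coe_lt_coe_iff.1 hwz)] with k hak hbk huk hk
  rw [EReal.coe_le_coe_iff, hbk]
  have := mul_le_mul_of_nonneg_left (EReal.coe_lt_coe_iff.1 hak).le huk.le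
  linarith

/-- The quotients `log x / log p` and `log y / log q` have the same limit superior if `x` is a fixed
positive multiple of `y` and `log q ∼ log p → ∞`. -/
theorem limsup_log_div_log_le {x y p q : ℕ → ℝ} {c : ℝ} (hc : 0 < c)
    (hxy : ∀ᶠ k in atTop, x k = c * y k) (hp : Tendsto p atTop atTop)
    (hq : Tendsto q atTop atTop)
    (hpq : Tendsto (fun k => Real.log (q k) / Real.log (p k)) atTop (𝓝 1)) :
    limsup (fun k => ((Real.log (x k) / Real.log (p k) : ℝ) : EReal)) atTop ≤
      limsup (fun k => ((Real.log (y k) / Real.log (q k) : ℝ) : EReal)) atTop := by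
  have hlogp := Real.tendsto_log_atTop.comp hp
  have hlogq := Real.tendsto_log_atTop.comp hq
  -- The exact difference `log (c * y k) - log (y k)`: since `Real.log 0 = 0`, it is `0`, not `log
  -- c`, when `y k = 0`.
  let d : ℕ → ℝ := fun k => if y k = 0 then 0 else Real.log c
  have hd : Tendsto (fun k => d k / Real.log (p k)) atTop (𝓝 0) := by
    refine squeeze_zero_norm' ?_ (hlogp.const_div_atTop |Real.log c|)
    filter_upwards [hlogp.eventually_gt_atTop 0] with k hk
    have hk' : 0 < Real.log (p k) := hk
    rw [norm_div, Real.norm_of_nonneg hk'.le, Function.comp_apply]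
    gcongr
    by_cases h : y k = 0 <;> simp [d, h]
  -- Here `log x / log p = (log q / log p) * (log y / log q) + d / log p`.
  refine limsup_coe_affine_le hpq hd ?_
  filter_upwards [hxy, hlogq.eventually_gt_atTop 0] with k hk hqk
  have hqk' : Real.log (q k) ≠ 0 := ne_of_gt hqk
  by_cases h : y k = 0
  · simp [hk, h, d]
  · rw [hk, Real.log_mul hc.ne' h]
    simp only [d, h, if_false]
    field_simp
    ring

/-! ### The intensity measure of a stationary point process -/

section Intensity

variable {n : ℕ} {Ω : Type*} [MeasurableSpace Ω] {P : Measure Ω} {ξ : Ω → Measure (E n)}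

theorem IsStationary.isAddLeftInvariant_bind (h : IsStationary P ξ) (hξ : Measurable ξ) :
    (P.bind ξ).IsAddLeftInvariant := by
  refine ⟨fun g => Measure.ext fun B hB => ?_⟩
  have hmeas : Measurable fun μ : Measure (E n) => μ B := Measure.measurable_coe hB
  have hid := ((h (-g)).comp hmeas).lintegral_eq
  simp only [sub_neg_eq_add, Function.comp_apply] at hid
  rw [Measure.map_apply (measurable_const_add g) hB,
    Measure.bind_apply (measurable_const_add g hB) hξ.aemeasurable,
    Measure.bind_apply hB hξ.aemeasurable, ← hid]
  refine lintegral_congr fun ω => ?_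
  rw [Measure.map_apply (measurable_add_const g) hB]
  simp only [add_comm g]

theorem HasAllFiniteMoments.bind_lt_top (h : HasAllFiniteMoments P ξ) (hξ : Measurable ξ)
    {B : Set (E n)} (hB : MeasurableSet B) (hb : Bornology.IsBounded B) : P.bind ξ B < ∞ := by
  rw [Measure.bind_apply hB hξ.aemeasurable]
  simpa using h 1 le_rfl B hB hb

/-- A translation-invariant measure is Haar once a single compact set with nonempty interior has
finite nonzero mass. The closed unit ball serves: its mass is finite by the first moment and nonzero
by positivity. -/
theorem isAddHaarMeasure_bind (hξ : Measurable ξ) (hs : IsStationary P ξ)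
    (hm : HasAllFiniteMoments P ξ) (hp : HasPositiveFirstMoments P ξ) :
    (P.bind ξ).IsAddHaarMeasure := by
  have := hs.isAddLeftInvariant_bind hξ
  have hK : MeasurableSet (Metric.closedBall (0 : E n) 1) := Metric.isClosed_closedBall.measurableSet
  refine Measure.isAddHaarMeasure_of_isCompact_nonempty_interior _ _
    (isCompact_closedBall (0 : E n) 1) ?_ ?_ (hm.bind_lt_top hξ hK Metric.isBounded_closedBall).ne
  · exact ⟨0, Metric.ball_subset_interior_closedBall (Metric.mem_ball_self one_pos)⟩
  · rw [Measure.bind_apply hK hξ.aemeasurable]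
    exact (hp _ hK Metric.isBounded_closedBall
      (Metric.measure_closedBall_pos volume _ one_pos)).ne'

theorem IsPointProcess.meanCount_eq (h : IsPointProcess ξ) {B : Set (E n)}
    (hB : MeasurableSet B) (hb : Bornology.IsBounded B) :
    meanCount P ξ B = (P.bind ξ B).toReal := by
  rw [meanCount, Measure.bind_apply hB h.measurable.aemeasurable]
  refine integral_toReal ((Measure.measurable_coe hB).comp h.measurable).aemeasurable
    (ae_of_all _ fun ω => ?_)
  obtain ⟨m, hm⟩ := h.integer_valued ω B hB hb
  simp [hm]

end Intensity

/-! ### Growth of the mean count along the averaging sequence -/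

theorem tendsto_measure_of_tendsto_inradius {n : ℕ} [NeZero n] (μ : Measure (E n))
    [μ.IsAddHaarMeasure] {A : ℕ → Set (E n)}
    (hA : Tendsto (fun k => inradius (A k)) atTop (𝓝 ∞)) :
    Tendsto (fun k => μ (A k)) atTop (𝓝 ∞) := by
  have huniv : Tendsto (fun N : ℕ => μ (Metric.closedBall (0 : E n) N)) atTop (𝓝 ∞) := by
    have := tendsto_measure_iUnion_atTop (μ := μ)
      (s := fun N : ℕ => Metric.closedBall (0 : E n) (N : ℝ))
      fun _ _ h => Metric.closedBall_subset_closedBall (Nat.cast_le.2 h)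
    -- Infinite total mass needs a noncompact space, hence `n ≠ 0`.
    rwa [Metric.iUnion_closedBall_nat, measure_univ_of_isAddLeftInvariant] at this
  refine ENNReal.tendsto_nhds_top fun m => ?_
  obtain ⟨N, hN⟩ :=
    (huniv.eventually (lt_mem_nhds (ENNReal.natCast_lt_top m))).exists
  filter_upwards [hA.eventually (lt_mem_nhds (ENNReal.natCast_lt_top N))] with k hk
  simp only [inradius, lt_iSup_iff] at hk
  obtain ⟨r, ⟨x, hx⟩, hr⟩ := hk
  have hNr : (N : ℝ) ≤ r := by exact_mod_cast hr.le
  calc (m : ℝ≥0∞) < μ (Metric.closedBall (0 : E n) N) := hN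
    _ = μ (Metric.closedBall x N) := (Measure.addHaar_closedBall_center μ x N).symm
    _ ≤ μ (A k) := measure_mono ((Metric.closedBall_subset_closedBall hNr).trans hx)

theorem tendsto_meanCount_atTop {n : ℕ} [NeZero n] {Ω : Type*} [MeasurableSpace Ω]
    {P : Measure Ω} {ξ : Ω → Measure (E n)} (hξ : IsPointProcess ξ) (hs : IsStationary P ξ)
    (hm : HasAllFiniteMoments P ξ) (hp : HasPositiveFirstMoments P ξ) {A : ℕ → Set (E n)}
    (hA : IsConvexAveragingSequence A) :
    Tendsto (fun k => meanCount P ξ (A k)) atTop atTop := by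
  have := isAddHaarMeasure_bind hξ.measurable hs hm hp
  have hfin : ∀ k, P.bind ξ (A k) ≠ ∞ := fun k =>
    (hm.bind_lt_top hξ.measurable (hA.measurableSet k) (hA.isBounded k)).ne
  simp only [fun k => hξ.meanCount_eq (P := P) (hA.measurableSet k) (hA.isBounded k)]
  refine tendsto_atTop.2 fun b => ?_
  filter_upwards [(tendsto_measure_of_tendsto_inradius (P.bind ξ)
    hA.inradius_tendsto).eventually (lt_mem_nhds ENNReal.ofReal_lt_top)] with k hk
  exact (ENNReal.ofReal_le_iff_le_toReal (hfin k)).1 hk.le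

/-! ### Expected total persistence as an integral over the expectation measure -/

section Persistence

theorem pers_pos (x : Delta) : 0 < pers x := sub_pos.2 x.2

theorem measurable_pers : Measurable pers :=
  (measurable_snd.comp measurable_subtype_coe).sub (measurable_fst.comp measurable_subtype_coe)

theorem measurable_ofReal_pers_rpow (α : ℝ) :
    Measurable fun x : Delta => ENNReal.ofReal (pers x ^ α) :=
  (measurable_pers.pow_const α).ennreal_ofReal

/-- The dilation of the half plane by a positive factor. -/
def dilate (κ : ℝ) (hκ : 0 < κ) (x : Delta) : Delta :=
  ⟨(κ * x.1.1, κ * x.1.2), mul_lt_mul_of_pos_left x.2 hκ⟩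

theorem measurable_dilate {κ : ℝ} (hκ : 0 < κ) : Measurable (dilate κ hκ) :=
  (((measurable_fst.comp measurable_subtype_coe).const_mul κ).prodMk
    ((measurable_snd.comp measurable_subtype_coe).const_mul κ)).subtype_mk

theorem pers_dilate {κ : ℝ} (hκ : 0 < κ) (x : Delta) : pers (dilate κ hκ x) = κ * pers x :=
  (mul_sub κ _ _).symm

theorem scaleSet_eq_preimage {κ : ℝ} (hκ : 0 < κ) (B : Set Delta) :
    scaleSet κ B = dilate κ⁻¹ (inv_pos.2 hκ) ⁻¹' B := by
  ext y
  constructor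
  · rintro ⟨x, hx, hy⟩
    have : dilate κ⁻¹ (inv_pos.2 hκ) y = x := by
      ext <;> simp [dilate, hy, hκ.ne']
    rwa [Set.mem_preimage, this]
  · intro hy
    refine ⟨_, hy, ?_⟩
    ext <;> simp [dilate, hκ.ne']

theorem lintegral_multiset_sum_dirac {X : Type*} [MeasurableSpace X] {f : X → ℝ≥0∞}
    (hf : Measurable f) (s : Multiset X) :
    ∫⁻ x, f x ∂(s.map Measure.dirac).sum = (s.map f).sum := by
  induction s using Multiset.induction_on with
  | empty => simp
  | cons a s ih => simp [lintegral_add_measure, lintegral_dirac' _ hf, ih]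

theorem ofReal_multiset_sum_map {X : Type*} {f : X → ℝ} (hf : ∀ x, 0 ≤ f x) (s : Multiset X) :
    ENNReal.ofReal (s.map f).sum = (s.map fun x => ENNReal.ofReal (f x)).sum := by
  induction s using Multiset.induction_on with
  | empty => simp
  | cons a s ih =>
    have : 0 ≤ (s.map f).sum := Multiset.sum_nonneg fun y hy => by
      obtain ⟨x, -, rfl⟩ := Multiset.mem_map.1 hy
      exact hf x
    simp [ENNReal.ofReal_add (hf a) this, ih]

variable {n : ℕ} {Ω : Type*} (F : Type*) [Field F]

theorem totalPersistence_nonneg (α : ℝ) (ξ : Ω → Measure (E n)) (A : Set (E n)) (ω : Ω) :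
    0 ≤ totalPersistence F α ξ A ω :=
  Multiset.sum_nonneg fun y hy => by
    obtain ⟨x, -, rfl⟩ := Multiset.mem_map.1 hy
    exact Real.rpow_nonneg (pers_pos x).le α

theorem lintegral_diagramMeasure (α : ℝ) (ξ : Ω → Measure (E n)) (A : Set (E n)) (ω : Ω) :
    ∫⁻ x, ENNReal.ofReal (pers x ^ α) ∂diagramMeasure F ξ A ω =
      ENNReal.ofReal (totalPersistence F α ξ A ω) := by
  rw [diagramMeasure, lintegral_multiset_sum_dirac (measurable_ofReal_pers_rpow α),
    totalPersistence, ofReal_multiset_sum_map fun x => Real.rpow_nonneg (pers_pos x).le α]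

variable [MeasurableSpace Ω] {P : Measure Ω}

/-- Campbell's formula: the expected total persistence is the integral of `pers ^ α` with respect to
the persistence diagram expectation measure. -/
theorem integral_totalPersistence (α : ℝ) {ξ : Ω → Measure (E n)} {A : Set (E n)}
    (h : AEMeasurable (diagramMeasure F ξ A) P) :
    ∫ ω, totalPersistence F α ξ A ω ∂P =
      (∫⁻ x, ENNReal.ofReal (pers x ^ α) ∂expectationMeasure F P ξ A).toReal := by
  have hf := measurable_ofReal_pers_rpow α
  have hmeas : AEMeasurable (fun ω => ENNReal.ofReal (totalPersistence F α ξ A ω)) P := by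
    simp only [← lintegral_diagramMeasure]
    exact (Measure.measurable_lintegral hf).comp_aemeasurable h
  have hreal : AEMeasurable (totalPersistence F α ξ A) P :=
    hmeas.ennreal_toReal.congr (ae_of_all _ fun ω =>
      ENNReal.toReal_ofReal (totalPersistence_nonneg F α ξ A ω))
  -- Integrability is not needed: if the expectation is infinite, the Bochner integral and `toReal
  -- ∞` are both `0`.
  rw [integral_eq_lintegral_of_nonneg_ae (ae_of_all _ (totalPersistence_nonneg F α ξ A))
    hreal.aestronglyMeasurable, expectationMeasure, Measure.lintegral_bind h hf.aemeasurable]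
  simp only [lintegral_diagramMeasure]

/-- The set `scaleSet κ B` is the preimage of `B` under dilation by `κ⁻¹`, so `μ` is `c` times the
pushforward of `ν` under that dilation. Homogeneity of `pers ^ α` then contributes the factor `κ⁻¹ ^
α`. -/
theorem lintegral_pers_rpow_of_scaling {μ ν : Measure Delta} {κ : ℝ} (hκ : 0 < κ) (c : ℝ≥0∞)
    (h : ∀ B : Set Delta, MeasurableSet B → μ B = c * ν (scaleSet κ B)) (α : ℝ) :
    ∫⁻ x, ENNReal.ofReal (pers x ^ α) ∂μ =
      c * ENNReal.ofReal (κ⁻¹ ^ α) * ∫⁻ x, ENNReal.ofReal (pers x ^ α) ∂ν := by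
  have hκ' := inv_pos.2 hκ
  have hμ : μ = c • ν.map (dilate κ⁻¹ hκ') := by
    refine Measure.ext fun B hB => ?_
    rw [h B hB, scaleSet_eq_preimage hκ, Measure.smul_apply,
      Measure.map_apply (measurable_dilate hκ') hB, smul_eq_mul]
  have hf := measurable_ofReal_pers_rpow α
  rw [hμ, lintegral_smul_measure, lintegral_map hf (measurable_dilate hκ'), smul_eq_mul, mul_assoc,
    ← lintegral_const_mul _ hf]
  congr 1
  refine lintegral_congr fun x => ?_
  rw [pers_dilate, Real.mul_rpow hκ'.le (pers_pos x).le,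
    ENNReal.ofReal_mul (Real.rpow_nonneg hκ'.le α)]

end Persistence

/-! ### Comparison of the processes at two parameters -/

theorem ExpectationMeasureNonzero.neZero {n : ℕ} {Ω : Type*} [MeasurableSpace Ω] {F : Type*}
    [Field F] {P : Measure Ω} {ξ : Ω → Measure (E n)}
    (h : ExpectationMeasureNonzero F P ξ) : NeZero n := by
  refine ⟨?_⟩
  rintro rfl
  obtain ⟨A, -, -, hA⟩ := h
  refine hA ?_
  have : diagramMeasure F ξ A = fun _ => 0 := by
    ext1 ω
    simp [diagramMeasure, totalDiagram]
  rw [expectationMeasure, this, Measure.bind_const, smul_zero]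

theorem ScalesSelfSimilarly.eventually_integral_totalPersistence_eq {n : ℕ} {Ω : Type*}
    [MeasurableSpace Ω] {F : Type*} [Field F] {P : Measure Ω} {T₀ T₁ η₁ η₂ : ℝ} (hT₀ : 0 < T₀)
    {ξ : ℝ → Ω → Measure (E n)} {A : ℕ → Set (E n)}
    (hscale : ScalesSelfSimilarly F P ξ A T₀ T₁ η₁ η₂) (hA : IsConvexAveragingSequence A)
    (hexists : ∀ t ∈ Set.Ioo T₀ T₁, ExpectationMeasureExists F P (ξ t)) (α : ℝ) {t t' : ℝ}
    (ht : t ∈ Set.Ioo T₀ T₁) (ht' : t' ∈ Set.Ioo T₀ T₁) :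
    ∀ᶠ k in atTop, ∫ ω, totalPersistence F α (ξ t) (A k) ω ∂P =
      ((t / t') ^ (-η₂) * ((t / t') ^ (-η₁))⁻¹ ^ α) *
        ∫ ω, totalPersistence F α (ξ t') (A k) ω ∂P := by
  have hpos : 0 < t / t' := div_pos (hT₀.trans ht.1) (hT₀.trans ht'.1)
  have hκ := Real.rpow_pos_of_pos hpos (-η₁)
  filter_upwards [hscale t ht t' ht'] with k hk
  -- The comparison takes place in `[0, ∞]`; `toReal` is multiplicative even at `∞`, so infinite
  -- expectations need no separate case.
  rw [integral_totalPersistence F α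
      ((hexists t ht).aemeasurable _ (hA.measurableSet k) (hA.isBounded k)),
    integral_totalPersistence F α
      ((hexists t' ht').aemeasurable _ (hA.measurableSet k) (hA.isBounded k)),
    lintegral_pers_rpow_of_scaling hκ _ hk α, ENNReal.toReal_mul, ENNReal.toReal_mul,
    ENNReal.toReal_ofReal (Real.rpow_nonneg hpos.le _),
    ENNReal.toReal_ofReal (Real.rpow_nonneg (inv_pos.2 hκ).le _)]

end PersistentScaling

theorem mainTheorem4 {n : ℕ} (F : Type*) [Field F] {Ω : Type*} [MeasurableSpace Ω]
    (P : MeasureTheory.Measure Ω) [MeasureTheory.IsProbabilityMeasure P]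
    (T₀ T₁ : ℝ) (hT₀ : 0 < T₀) (hT : T₀ < T₁)
    (ξ : ℝ → Ω → MeasureTheory.Measure (PersistentScaling.E n))
    (hpoint : ∀ t ∈ Set.Ioo T₀ T₁, PersistentScaling.IsPointProcess (ξ t))
    (hsimple : ∀ t ∈ Set.Ioo T₀ T₁, PersistentScaling.IsSimple P (ξ t))
    (hstationary : ∀ t ∈ Set.Ioo T₀ T₁, PersistentScaling.IsStationary P (ξ t))
    (hmoments : ∀ t ∈ Set.Ioo T₀ T₁, PersistentScaling.HasAllFiniteMoments P (ξ t))
    (hpositive : ∀ t ∈ Set.Ioo T₀ T₁, PersistentScaling.HasPositiveFirstMoments P (ξ t))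
    (hexists : ∀ t ∈ Set.Ioo T₀ T₁, PersistentScaling.ExpectationMeasureExists F P (ξ t))
    (hnonzero : ∀ t ∈ Set.Ioo T₀ T₁, PersistentScaling.ExpectationMeasureNonzero F P (ξ t))
    (A : ℕ → Set (PersistentScaling.E n)) (hA : PersistentScaling.IsConvexAveragingSequence A)
    (η₁ η₂ : ℝ) (hscale : PersistentScaling.ScalesSelfSimilarly F P ξ A T₀ T₁ η₁ η₂)
    (hlog : ∀ t ∈ Set.Ioo T₀ T₁, ∀ t' ∈ Set.Ioo T₀ T₁,
      Filter.Tendsto (fun k => Real.log (PersistentScaling.meanCount P (ξ t') (A k)) /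
        Real.log (PersistentScaling.meanCount P (ξ t) (A k))) Filter.atTop (nhds 1)) :
    ∀ α : ℝ, 0 < α → ∀ t ∈ Set.Ioo T₀ T₁, ∀ t' ∈ Set.Ioo T₀ T₁,
      PersistentScaling.growthExponent F P α (ξ t) A =
          PersistentScaling.growthExponent F P α (ξ t') A ∧
        PersistentScaling.dimPH F P α (ξ t) A = PersistentScaling.dimPH F P α (ξ t') A := by
  intro α _
  have key : ∀ t ∈ Set.Ioo T₀ T₁, ∀ t' ∈ Set.Ioo T₀ T₁,
      PersistentScaling.growthExponent F P α (ξ t) A ≤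
        PersistentScaling.growthExponent F P α (ξ t') A := by
    intro t ht t' ht'
    -- In dimension `0` no homological degree is counted and every expectation measure vanishes; `n
    -- ≠ 0` is what lets the mean counts diverge.
    have := (hnonzero t ht).neZero
    have hcount : ∀ s ∈ Set.Ioo T₀ T₁,
        Filter.Tendsto (fun k => PersistentScaling.meanCount P (ξ s) (A k))
          Filter.atTop Filter.atTop := fun s hs =>
      PersistentScaling.tendsto_meanCount_atTop (hpoint s hs) (hstationary s hs) (hmoments s hs)
        (hpositive s hs) hA
    have hpos : 0 < t / t' := div_pos (hT₀.trans ht.1) (hT₀.trans ht'.1)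
    exact PersistentScaling.limsup_log_div_log_le (by positivity)
      (hscale.eventually_integral_totalPersistence_eq hT₀ hA hexists α ht ht')
      (hcount t ht) (hcount t' ht') (hlog t ht t' ht')
  intro t ht t' ht'
  have h := (key t ht t' ht').antisymm (key t' ht' t ht)
  refine ⟨h, ?_⟩
  simp only [PersistentScaling.dimPH, h]
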